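/- All graphs are finite and simple. A graph is traceable if it contains a spanning path; the order of a graph is its number of vertices; a cut-edge of a connected graph is an edge whose removal disconnects it. The Cartesian product $G_1\square G_2$ is the graph with vertex set $V(G_1)\times V(G_2)$ in which $(v,u)$ and $(v',u')$ are adjacent if and only if either $v=v'$ and $uu'\in E(G_2)$, or $u=u'$ and $vv'\in E(G_1)$. **Corollary.** Let $G_1$ be a traceable graph of order at least $3$. If $G_2$ is a connected $3$-regular graph with no cut-edge, then $G_1\square G_2$ has a Hamiltonian cycle, i.e. a cycle passing through every vertex of $G_1\square G_2$. -/

import Mathlib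

/-- A graph is traceable if it contains a spanning path (a Hamiltonian path). -/
def SimpleGraph.IsTraceable {V : Type*} [DecidableEq V] (G : SimpleGraph V) : Prop :=
  ∃ (u v : V) (p : G.Walk u v), p.IsHamiltonian

/-! A perfect matching `M` of `G₂` cuts the product into ladders (Hamiltonian path `p` of `G₁` times
a matching edge), each spanned by a cycle containing both rails. These cycles are merged one at a
time along edges of `G₂`: a rail edge in each of two neighbouring fibres is traded for two rungs. A
merge never gets stuck because each covered fibre keeps at least as many edges of `p` as it has
neighbours still uncovered. Initially it has `|V| - 1` edges, against at most `|V| - 1` neighbours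
other than its mate.

`M` comes from Petersen's theorem, via Tutte: each odd component left by deleting `u` sends at least
3 edges to `u`, which can receive only `3|u|`. -/

namespace SimpleGraph

/-! ### Petersen's theorem -/

section Petersen

open Finset

theorem even_sum_card_neighborFinset_inter {W : Type*} [Fintype W] [DecidableEq W]
    (G : SimpleGraph W) [DecidableRel G.Adj] (K : Finset W) :
    Even (∑ k ∈ K, #(G.neighborFinset k ∩ K)) := by
  -- The edges inside `K`, kept on the full vertex type so that the handshake lemma applies.
  let H : SimpleGraph W :=
    { Adj := fun a b => G.Adj a b ∧ a ∈ K ∧ b ∈ K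
      symm := ⟨fun a b h => ⟨h.1.symm, h.2.2, h.2.1⟩⟩
      loopless := ⟨fun a h => h.1.ne rfl⟩ }
  have : DecidableRel H.Adj := fun a b => inferInstanceAs (Decidable (_ ∧ _))
  have h1 : ∑ k ∈ K, #(G.neighborFinset k ∩ K) = ∑ k, H.degree k := by
    rw [← Finset.sum_subset (Finset.subset_univ K)]
    · refine Finset.sum_congr rfl fun k hk => ?_
      rw [← card_neighborFinset_eq_degree]
      congr 1
      ext b
      simp [H, hk]
    · intro k _ hk
      rw [← card_neighborFinset_eq_degree, Finset.card_eq_zero]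
      ext b
      simp [H, hk]
  rw [h1, sum_degrees_eq_twice_card_edges]
  exact even_two_mul _

/-- In a bridgeless cubic graph at least three edges leave each set of odd cardinality. -/
theorem three_le_sum_card_neighborFinset_sdiff {W : Type*} [Fintype W] [DecidableEq W]
    {G : SimpleGraph W} [DecidableRel G.Adj] (hreg : G.IsRegularOfDegree 3)
    (hcut : ∀ e ∈ G.edgeSet, ¬ G.IsBridge e) {K : Finset W} (hK : Odd #K) :
    3 ≤ ∑ k ∈ K, #(G.neighborFinset k \ K) := by
  have hsum : ∑ k ∈ K, #(G.neighborFinset k ∩ K) + ∑ k ∈ K, #(G.neighborFinset k \ K)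
      = 3 * #K := by
    rw [← Finset.sum_add_distrib, Finset.sum_congr rfl (g := fun _ => 3)]
    · simp [mul_comm]
    · intro k _
      rw [Finset.card_inter_add_card_sdiff, card_neighborFinset_eq_degree, hreg k]
  have hodd : Odd (∑ k ∈ K, #(G.neighborFinset k \ K)) := by
    have h3 : Odd (3 * #K) := Odd.mul (by decide) hK
    rw [← hsum, Nat.odd_add'] at h3
    exact h3.2 (G.even_sum_card_neighborFinset_inter K)
  -- A sole leaving edge is not a bridge, so a walk avoiding it joins its ends; that walk must leave
  -- `K` by a second edge.
  have hone : ∑ k ∈ K, #(G.neighborFinset k \ K) ≠ 1 := by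
    rw [← Finset.card_sigma]
    intro h
    obtain ⟨⟨k, s⟩, hks⟩ := Finset.card_eq_one.1 h
    have hmem : ∀ a b, (a ∈ K ∧ G.Adj a b ∧ b ∉ K) ↔ (a = k ∧ b = s) := by
      intro a b
      have := Finset.ext_iff.1 hks ⟨a, b⟩
      simpa using this
    obtain ⟨hk, hadj, hs⟩ := (hmem k s).2 ⟨rfl, rfl⟩
    have hb := hcut s(k, s) hadj
    rw [isBridge_iff, not_not] at hb
    obtain ⟨p⟩ := hb
    obtain ⟨d, -, hd1, hd2⟩ := p.exists_boundary_dart (K : Set W) hk hs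
    have hd := d.adj
    rw [deleteEdges_adj] at hd
    obtain ⟨e1, e2⟩ := (hmem d.fst d.snd).1 ⟨hd1, hd.1, hd2⟩
    apply hd.2
    rw [e1, e2]
    rfl
  obtain ⟨m, hm⟩ := hodd
  omega

/-- **Petersen's theorem**: every bridgeless cubic graph has a perfect matching. -/
theorem exists_isPerfectMatching_of_isRegularOfDegree_three {W : Type*} [Fintype W]
    [DecidableEq W] {G : SimpleGraph W} [DecidableRel G.Adj] (hreg : G.IsRegularOfDegree 3)
    (hcut : ∀ e ∈ G.edgeSet, ¬ G.IsBridge e) : ∃ M : G.Subgraph, M.IsPerfectMatching := by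
  classical
  rw [tutte]
  intro u hu
  rw [IsTutteViolator] at hu
  set D := (⊤ : G.Subgraph).deleteVerts u with hD
  have : Fintype D.verts := Fintype.ofFinite _
  have : Fintype D.coe.ConnectedComponent := Fintype.ofFinite _
  let f : W → ℕ := fun k => #(G.neighborFinset k ∩ u.toFinset)
  have hcomp : ∀ c ∈ D.coe.oddComponents.toFinset,
      3 ≤ ∑ k : D.verts with D.coe.connectedComponentMk k = c, f k := by
    intro c hc
    have hc' : Odd c.supp.ncard := by simpa using hc
    let K : Finset W :=
      ((Finset.univ : Finset D.verts).filter fun k => D.coe.connectedComponentMk k = c).map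
        (Function.Embedding.subtype _)
    have hKodd : Odd #K := by
      rw [Finset.card_map]
      convert hc'
      rw [Set.ncard_eq_toFinset_card']
      congr 1
      ext k
      simp
    refine (three_le_sum_card_neighborFinset_sdiff hreg hcut hKodd).trans ?_
    rw [Finset.sum_map]
    refine Finset.sum_le_sum fun k hk => Finset.card_le_card fun b hb => ?_
    simp only [Finset.mem_filter, Finset.mem_univ, true_and] at hk
    simp only [Finset.mem_sdiff, Function.Embedding.coe_subtype] at hb
    simp only [Finset.mem_inter, mem_neighborFinset, Set.mem_toFinset]
    refine ⟨(G.mem_neighborFinset _ _).1 hb.1, ?_⟩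
    -- A neighbour outside `u` would lie in the same component.
    by_contra hbu
    apply hb.2
    have hbD : b ∈ D.verts := by simp [hD, hbu]
    have hkD : (k : W) ∉ u := by
      have := k.2
      simpa [hD] using this
    refine Finset.mem_map.2 ⟨⟨b, hbD⟩, ?_, rfl⟩
    simp only [Finset.mem_filter, Finset.mem_univ, true_and]
    rw [← hk]
    refine (ConnectedComponent.connectedComponentMk_eq_of_adj ?_).symm
    refine Subgraph.deleteVerts_adj.2 ⟨trivial, hkD, trivial, hbu, ?_⟩
    exact (G.mem_neighborFinset _ _).1 hb.1
  have h1 : 3 * #(D.coe.oddComponents.toFinset) ≤ ∑ k : W, f k := by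
    calc 3 * #(D.coe.oddComponents.toFinset)
        ≤ ∑ c ∈ D.coe.oddComponents.toFinset,
            ∑ k : D.verts with D.coe.connectedComponentMk k = c, f k := by
          rw [mul_comm]
          exact Finset.card_nsmul_le_sum _ _ _ hcomp
      _ ≤ ∑ c, ∑ k : D.verts with D.coe.connectedComponentMk k = c, f k :=
          Finset.sum_le_sum_of_subset (Finset.subset_univ _)
      _ = ∑ k : D.verts, f k := Finset.sum_fiberwise _ _ _
      _ = ∑ k ∈ (Finset.univ : Finset D.verts).map (Function.Embedding.subtype _), f k := by
          rw [Finset.sum_map]; rfl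
      _ ≤ ∑ k : W, f k := Finset.sum_le_sum_of_subset (Finset.subset_univ _)
  -- Double counting, from the side of `u`.
  have h2 : ∑ k : W, f k = 3 * #u.toFinset := by
    have : ∀ k, f k = #(Finset.bipartiteAbove G.Adj u.toFinset k) := by
      intro k
      refine congrArg Finset.card ?_
      ext b
      simp [Finset.bipartiteAbove, and_comm]
    simp only [this]
    rw [Finset.sum_card_bipartiteAbove_eq_sum_card_bipartiteBelow, mul_comm,
      ← smul_eq_mul, ← Finset.sum_const]
    refine Finset.sum_congr rfl fun s _ => ?_
    rw [← hreg s, ← card_neighborFinset_eq_degree]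
    congr 1
    ext b
    simp [Finset.bipartiteBelow, adj_comm]
  rw [Set.ncard_eq_toFinset_card', Set.ncard_eq_toFinset_card'] at hu
  omega

end Petersen

/-! ### Opening and merging cycles -/

namespace Walk

/-- Opening a cycle at one of its edges yields a path through all its vertices. -/
theorem IsCycle.exists_isPath_of_mem_edges {V : Type*} [DecidableEq V] {G : SimpleGraph V}
    {x p q : V} {c : G.Walk x x} (hc : c.IsCycle) (he : s(p, q) ∈ c.edges) :
    ∃ P : G.Walk q p, P.IsPath ∧ (∀ v, v ∈ P.support ↔ v ∈ c.support) ∧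
      ∀ e ∈ c.edges, e = s(p, q) ∨ e ∈ P.edges := by
  have base : ∀ d : G.Walk p p, d.IsCycle → d.snd = q →
      ∃ P : G.Walk q p, P.IsPath ∧ (∀ v, v ∈ P.support ↔ v ∈ d.support) ∧
      ∀ e ∈ d.edges, e = s(p, q) ∨ e ∈ P.edges := by
    intro d hd hq
    cases d with
    | nil => exact absurd hd not_isCycle_nil
    | cons h t =>
      simp only [snd_cons] at hq
      subst hq
      refine ⟨t, ((cons_isCycle_iff _ _).1 hd).1, fun v => ?_, fun e he => ?_⟩
      · simp only [support_cons, List.mem_cons]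
        exact ⟨Or.inr, fun h => h.elim (fun h => h ▸ t.end_mem_support) id⟩
      · simpa using he
  have hp : p ∈ c.support := c.fst_mem_support_of_mem_edges he
  have hrot : ∀ e, e ∈ (c.rotate p hp).edges ↔ e ∈ c.edges :=
    fun e => (c.rotate_edges p hp).mem_iff
  have hd : (c.rotate p hp).IsCycle := (isCycle_rotate hp).2 hc
  -- Once the cycle starts at `p`, the edge `pq` is its first or its last; reversal reduces the
  -- latter to the former.
  have key : (c.rotate p hp).snd = q ∨ (c.rotate p hp).reverse.snd = q := by
    have he' := (hrot _).2 he
    generalize c.rotate p hp = d at hd he'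
    cases d with
    | nil => simp at he'
    | cons h t =>
      rw [edges_cons, List.mem_cons] at he'
      obtain he' | he' := he'
      · left
        rw [Sym2.eq_iff] at he'
        obtain he' | he' := he'
        · exact (snd_cons t h).trans he'.2.symm
        · exact absurd he'.1 h.ne
      · right
        have := ((cons_isCycle_iff _ _).1 hd).1.eq_penultimate_of_mem_edges he'
        have hn : ¬ t.Nil := by
          intro hn
          exact h.ne hn.eq.symm
        rw [snd_reverse, penultimate_cons_of_not_nil _ _ hn, this]
  obtain h | h := key
  · obtain ⟨P, h1, h2, h3⟩ := base _ hd h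
    exact ⟨P, h1, fun v => (h2 v).trans (c.mem_support_rotate_iff p hp),
      fun e he => h3 e ((hrot e).2 he)⟩
  · obtain ⟨P, h1, h2, h3⟩ := base _ hd.reverse h
    refine ⟨P, h1, fun v => (h2 v).trans ?_, fun e he => h3 e ?_⟩
    · rw [support_reverse, List.mem_reverse]
      exact c.mem_support_rotate_iff p hp
    · rw [edges_reverse, List.mem_reverse]
      exact (hrot e).2 he

/-- Two vertex-disjoint cycles can be merged along a pair of parallel edges. -/
theorem IsCycle.exists_merge {V : Type*} [DecidableEq V] {G : SimpleGraph V}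
    {x y p q p' q' : V} {c : G.Walk x x} {d : G.Walk y y} (hc : c.IsCycle) (hd : d.IsCycle)
    (he : s(p, q) ∈ c.edges) (he' : s(p', q') ∈ d.edges)
    (hdisj : ∀ v ∈ c.support, v ∉ d.support) (hp : G.Adj p p') (hq : G.Adj q q') :
    ∃ (z : V) (b : G.Walk z z), b.IsCycle ∧
      (∀ v, v ∈ b.support ↔ v ∈ c.support ∨ v ∈ d.support) ∧
      (∀ e ∈ c.edges, e = s(p, q) ∨ e ∈ b.edges) ∧
      ∀ e ∈ d.edges, e = s(p', q') ∨ e ∈ b.edges := by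
  obtain ⟨P, hP, hPs, hPe⟩ := hc.exists_isPath_of_mem_edges he
  obtain ⟨Q, hQ, hQs, hQe⟩ := hd.exists_isPath_of_mem_edges (Sym2.eq_swap ▸ he')
  have hR : (cons hp Q).IsPath := by
    refine hQ.cons fun h => hdisj p ((hPs _).1 P.end_mem_support) ((hQs _).1 h)
  have hR' : (P.append (cons hp Q)).IsPath := by
    rw [isPath_def, support_append]
    refine List.Nodup.append hP.support_nodup (by simpa using hQ.support_nodup) ?_
    intro v h1 h2
    exact hdisj v ((hPs _).1 h1) ((hQs _).1 (by simpa using h2))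
  -- The merged cycle runs `q' → q`, along `P` to `p`, then `p → p'`, and along `Q` back to `q'`.
  refine ⟨q', cons hq.symm (P.append (cons hp Q)), ?_, ?_, ?_, ?_⟩
  · rw [cons_isCycle_iff]
    refine ⟨hR', fun h => ?_⟩
    have hq'd : q' ∈ d.support := (hQs _).1 Q.end_mem_support
    have hqc : q ∈ c.support := (hPs _).1 P.start_mem_support
    rw [edges_append, edges_cons, List.mem_append, List.mem_cons] at h
    obtain h | h | h := h
    · exact hdisj q' ((hPs _).1 (P.fst_mem_support_of_mem_edges h)) hq'd
    · have hne : p' ≠ q' := (d.adj_of_mem_edges he').ne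
      rw [Sym2.eq_iff] at h
      obtain ⟨h, -⟩ | ⟨h, -⟩ := h
      · exact hdisj q' (h ▸ (hPs _).1 P.end_mem_support) hq'd
      · exact hne h.symm
    · exact hdisj q hqc ((hQs _).1 (Q.snd_mem_support_of_mem_edges h))
  · intro v
    rw [← hPs, ← hQs]
    simp only [support_cons, List.mem_cons, mem_support_append_iff]
    constructor
    · rintro (rfl | h | rfl | h)
      · exact .inr Q.end_mem_support
      · exact .inl h
      · exact .inl P.end_mem_support
      · exact .inr h
    · tauto
  · intro e h
    simp only [edges_cons, edges_append, List.mem_cons, List.mem_append]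
    have := hPe e h
    tauto
  · intro e h
    simp only [edges_cons, edges_append, List.mem_cons, List.mem_append]
    have := hQe e h
    rw [Sym2.eq_swap] at this
    tauto

theorem support_boxProdLeft {V W : Type*} {G : SimpleGraph V} (H : SimpleGraph W) {u v : V}
    (p : G.Walk u v) (a : W) : (p.boxProdLeft H a).support = p.support.map (·, a) :=
  p.support_map (G.boxProdLeft H a).toHom

theorem edges_boxProdLeft {V W : Type*} {G : SimpleGraph V} (H : SimpleGraph W) {u v : V}
    (p : G.Walk u v) (a : W) : (p.boxProdLeft H a).edges = p.edges.map (Sym2.map (·, a)) :=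
  p.edges_map (G.boxProdLeft H a).toHom

end Walk

/-! ### Ladders and the product -/

/-- The ladder over a path of positive length and an edge is traversed by a cycle containing both
side rails. -/
theorem exists_isCycle_boxProd_of_isPath {V W : Type*} [DecidableEq V] [DecidableEq W]
    {G : SimpleGraph V} {H : SimpleGraph W} {u v : V} {p : G.Walk u v} (hp : p.IsPath)
    (hlen : 1 ≤ p.length) {a b : W} (hab : H.Adj a b) :
    ∃ (z : V × W) (c : (G.boxProd H).Walk z z), c.IsCycle ∧
      (∀ x, x ∈ c.support ↔ x.1 ∈ p.support ∧ (x.2 = a ∨ x.2 = b)) ∧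
      ∀ e ∈ p.edges, e.map (·, a) ∈ c.edges ∧ e.map (·, b) ∈ c.edges := by
  set P : (G.boxProd H).Walk (u, a) (v, a) := p.boxProdLeft H a with hPdef
  set Q : (G.boxProd H).Walk (v, b) (u, b) := (p.boxProdLeft H b).reverse with hQdef
  have hPs : ∀ x, x ∈ P.support ↔ x.1 ∈ p.support ∧ x.2 = a := by
    rintro ⟨x, y⟩
    simp [hPdef, Walk.support_boxProdLeft, eq_comm]
  have hQs : ∀ x, x ∈ Q.support ↔ x.1 ∈ p.support ∧ x.2 = b := by
    rintro ⟨x, y⟩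
    simp [hQdef, Walk.support_boxProdLeft, eq_comm]
  have hP : P.IsPath := Walk.IsPath.map (G.boxProdLeft H a).injective hp
  have hQ : Q.IsPath := (Walk.IsPath.map (G.boxProdLeft H b).injective hp).reverse
  have h1 : (G.boxProd H).Adj (v, a) (v, b) := boxProd_adj_right.2 hab
  have h2 : (G.boxProd H).Adj (u, b) (u, a) := boxProd_adj_right.2 hab.symm
  have hne := hab.ne
  -- Otherwise the two closing rungs would be the same edge.
  have huv : u ≠ v := by
    rintro rfl
    have := (Walk.isPath_iff_nil.1 hp)
    rw [← Walk.length_eq_zero_iff] at this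
    omega
  have hR : (P.append (Walk.cons h1 Q)).IsPath := by
    rw [Walk.isPath_def, Walk.support_append]
    refine List.Nodup.append hP.support_nodup (by simpa using hQ.support_nodup) ?_
    intro x hx hx'
    rw [hPs] at hx
    rw [Walk.support_cons, List.tail_cons, hQs] at hx'
    exact hne (hx.2.symm.trans hx'.2)
  refine ⟨(u, b), Walk.cons h2 (P.append (Walk.cons h1 Q)), ?_, ?_, ?_⟩
  · rw [Walk.cons_isCycle_iff]
    refine ⟨hR, fun h => ?_⟩
    rw [Walk.edges_append, Walk.edges_cons, List.mem_append, List.mem_cons] at h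
    obtain h | h | h := h
    · exact hne ((hPs _).1 (P.fst_mem_support_of_mem_edges h)).2.symm
    · simp [huv] at h
    · exact hne ((hQs _).1 (Q.snd_mem_support_of_mem_edges h)).2
  · intro x
    simp only [Walk.support_cons, List.mem_cons, Walk.mem_support_append_iff, hPs, hQs]
    constructor
    · rintro (rfl | h | rfl | h)
      · simp
      · tauto
      · simp
      · tauto
    · tauto
  · intro e he
    simp only [Walk.edges_cons, Walk.edges_append, List.mem_cons, List.mem_append]
    constructor
    · refine .inr (.inl ?_)
      rw [hPdef, Walk.edges_boxProdLeft]
      exact List.mem_map_of_mem he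
    · refine .inr (.inr (.inr ?_))
      rw [hQdef, Walk.edges_reverse, List.mem_reverse, Walk.edges_boxProdLeft]
      exact List.mem_map_of_mem he

/-- The Cartesian product of a traceable graph of order `n ≥ 2` and a connected graph of maximum
degree at most `n` with a perfect matching has a Hamiltonian cycle. -/
theorem exists_isHamiltonianCycle_boxProd {V W : Type*} [Fintype V] [DecidableEq V] [Fintype W]
    [DecidableEq W] {G : SimpleGraph V} {H : SimpleGraph W} [DecidableRel H.Adj] {u v : V}
    {p : G.Walk u v} (hp : p.IsHamiltonian) (hV : 2 ≤ Fintype.card V) (hH : H.Connected)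
    (hdeg : ∀ w, H.degree w ≤ Fintype.card V) {M : H.Subgraph} (hM : M.IsPerfectMatching) :
    ∃ (z : V × W) (c : (G.boxProd H).Walk z z), c.IsHamiltonianCycle := by
  have hlen := hp.length_eq
  have hcard : p.edges.toFinset.card = Fintype.card V - 1 := by
    rw [List.toFinset_card_of_nodup hp.isPath.isTrail.edges_nodup, Walk.length_edges, hlen]
  have hdiff : ∀ {w : W} {S T : Finset W}, T ⊆ S → T ⊆ H.neighborFinset w →
      (H.neighborFinset w \ S).card ≤ Fintype.card V - T.card := by
    intro w S T hTS hTN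
    refine (Finset.card_le_card (Finset.sdiff_subset_sdiff subset_rfl hTS)).trans ?_
    rw [Finset.card_sdiff_of_subset hTN, card_neighborFinset_eq_degree]
    exact Nat.sub_le_sub_right (hdeg w) _
  -- `S` is a union of matching edges, `c` spans exactly the fibres over `S`, and each fibre retains
  -- one edge of `p` per neighbour outside `S`.
  let Inv (S : Finset W) : Prop := S.Nonempty ∧ (∀ a ∈ S, ∀ b, M.Adj a b → b ∈ S) ∧
    ∃ (z : V × W) (c : (G.boxProd H).Walk z z), c.IsCycle ∧ (∀ x, x ∈ c.support ↔ x.2 ∈ S) ∧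
      ∀ w ∈ S, (H.neighborFinset w \ S).card ≤
        (p.edges.toFinset.filter fun e => e.map (·, w) ∈ c.edges).card
  have hmate : ∀ a b, M.Adj a b → ∀ d, M.Adj a d → d = b := fun a b hab d had =>
    hM.1.eq_of_adj_left had hab
  have hstart : ∃ S, Inv S := by
    obtain ⟨a⟩ := hH.nonempty
    obtain ⟨b, hab, -⟩ := hM.1 (hM.2 a)
    obtain ⟨z, c, hc, hcs, hce⟩ :=
      exists_isCycle_boxProd_of_isPath hp.isPath (by omega) hab.adj_sub
    refine ⟨{a, b}, ⟨a, by simp⟩, ?_, z, c, hc, ?_, ?_⟩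
    · intro d hd e hde
      simp only [Finset.mem_insert, Finset.mem_singleton] at hd ⊢
      obtain rfl | rfl := hd
      · exact .inr (hmate _ _ hab _ hde)
      · exact .inl (hmate _ _ hab.symm _ hde)
    · intro x
      simp [hcs, hp.mem_support]
    · intro w hw
      rw [Finset.mem_insert, Finset.mem_singleton] at hw
      obtain rfl | rfl := hw
      · rw [Finset.filter_true_of_mem fun e he => (hce e (List.mem_toFinset.1 he)).1, hcard]
        exact hdiff (T := {b}) (by simp) (by simpa using hab.adj_sub)
      · rw [Finset.filter_true_of_mem fun e he => (hce e (List.mem_toFinset.1 he)).2, hcard]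
        exact hdiff (T := {a}) (by simp) (by simpa using hab.adj_sub.symm)
  have hstep : ∀ S, Inv S → S ≠ Finset.univ → ∃ S', Inv S' ∧ S.card < S'.card := by
    rintro S ⟨⟨s, hs⟩, hSM, z, c, hc, hcs, hce⟩ hSu
    obtain ⟨t, ht⟩ : ∃ t, t ∉ S := by
      by_contra! h
      exact hSu (Finset.eq_univ_iff_forall.2 h)
    obtain ⟨r⟩ := hH.preconnected s t
    obtain ⟨⟨⟨w, a⟩, hwa⟩, -, hw, ha⟩ := r.exists_boundary_dart (S : Set W) hs ht
    simp only [Finset.mem_coe] at hw ha hwa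
    obtain ⟨b, hab, -⟩ := hM.1 (hM.2 a)
    have hb : b ∉ S := fun hb => ha (hSM b hb a hab.symm)
    have hadj := hab.adj_sub
    have hane := hadj.ne
    obtain ⟨y, d, hd, hds, hde⟩ := exists_isCycle_boxProd_of_isPath hp.isPath (by omega) hadj
    have haw : a ∈ H.neighborFinset w \ S := by simpa [ha] using hwa
    -- The uncovered neighbour `a` guarantees a spare edge `e` in the fibre of `w`.
    obtain ⟨e, he⟩ := Finset.card_pos.1 ((Finset.card_pos.2 ⟨a, haw⟩).trans_le (hce w hw))
    rw [Finset.mem_filter, List.mem_toFinset] at he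
    obtain ⟨hep, hec⟩ := he
    have hinj : ∀ (k l : W) (f g : Sym2 V), f.map (·, k) = g.map (·, l) → f = g ∧ k = l := by
      intro k l f g h
      have hkl : k = l := by
        induction f, g using Sym2.inductionOn₂ with
        | _ f₁ f₂ g₁ g₂ =>
          simp only [Sym2.map_mk, Sym2.eq_iff, Prod.mk.injEq] at h
          tauto
      subst hkl
      exact ⟨Sym2.map.injective (fun _ _ h => congrArg Prod.fst h) h, rfl⟩
    obtain ⟨y', c', hc', hcs', hce', hde'⟩ : ∃ (y' : V × W) (c' : (G.boxProd H).Walk y' y'),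
        c'.IsCycle ∧ (∀ x, x ∈ c'.support ↔ x ∈ c.support ∨ x ∈ d.support) ∧
        (∀ f ∈ c.edges, f = e.map (·, w) ∨ f ∈ c'.edges) ∧
        ∀ f ∈ d.edges, f = e.map (·, a) ∨ f ∈ c'.edges := by
      have hed := (hde e hep).1
      induction e using Sym2.inductionOn with
      | _ i j =>
        refine hc.exists_merge hd hec hed ?_ (boxProd_adj_right.2 hwa) (boxProd_adj_right.2 hwa)
        intro x hx hx'
        rw [hcs] at hx
        rw [hds] at hx'
        obtain ⟨-, h | h⟩ := hx'
        · exact ha (h ▸ hx)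
        · exact hb (h ▸ hx)
    refine ⟨insert a (insert b S), ⟨⟨a, by simp⟩, ?_, y', c', hc', ?_, ?_⟩, ?_⟩
    · intro k hk l hkl
      simp only [Finset.mem_insert] at hk ⊢
      obtain rfl | rfl | hk := hk
      · exact .inr (.inl (hmate _ _ hab _ hkl))
      · exact .inl (hmate _ _ hab.symm _ hkl)
      · exact .inr (.inr (hSM k hk l hkl))
    · intro x
      simp only [hcs', hcs, hds, hp.mem_support, true_and, Finset.mem_insert]
      tauto
    · intro k hk
      simp only [Finset.mem_insert] at hk
      obtain rfl | rfl | hk := hk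
      -- The fibre of `a` loses `e`, but both `b` and `w` are now covered.
      · refine (hdiff (T := {b, w}) ?_ ?_).trans ?_
        · simp [Finset.insert_subset_iff, hw]
        · simp [Finset.insert_subset_iff, hadj, hwa.symm]
        · have hbw : b ≠ w := fun h => hb (h ▸ hw)
          rw [Finset.card_pair hbw]
          have h1 : (p.edges.toFinset.erase e).card = Fintype.card V - 2 := by
            rw [Finset.card_erase_of_mem (List.mem_toFinset.2 hep), hcard]
            omega
          rw [← h1]
          refine Finset.card_le_card fun f hf => ?_
          rw [Finset.mem_erase, List.mem_toFinset] at hf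
          rw [Finset.mem_filter, List.mem_toFinset]
          exact ⟨hf.2, (hde' _ (hde f hf.2).1).resolve_left fun h => hf.1 (hinj _ _ _ _ h).1⟩
      · refine (hdiff (T := {a}) (by simp) (by simpa using hadj.symm)).trans ?_
        rw [Finset.card_singleton, ← hcard]
        refine Finset.card_le_card fun f hf => ?_
        rw [Finset.mem_filter]
        rw [List.mem_toFinset] at hf
        exact ⟨List.mem_toFinset.2 hf, (hde' _ (hde f hf).2).resolve_left fun h =>
          hane (hinj _ _ _ _ h).2.symm⟩
      · have hsub : H.neighborFinset k \ insert a (insert b S) ⊆ H.neighborFinset k \ S :=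
          Finset.sdiff_subset_sdiff subset_rfl (by intro; simp; tauto)
        -- Among the old fibres only that of `w` loses an edge, and there `a` stops being an
        -- uncovered neighbour.
        by_cases hkw : k = w
        · subst hkw
          calc (H.neighborFinset k \ insert a (insert b S)).card
              ≤ ((H.neighborFinset k \ S).erase a).card := by
                refine Finset.card_le_card fun f hf => ?_
                refine Finset.mem_erase.2 ⟨?_, hsub hf⟩
                rintro rfl
                simp at hf
            _ = (H.neighborFinset k \ S).card - 1 := Finset.card_erase_of_mem haw
            _ ≤ (p.edges.toFinset.filter fun e => e.map (·, k) ∈ c.edges).card - 1 :=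
                Nat.sub_le_sub_right (hce k hk) 1
            _ ≤ ((p.edges.toFinset.filter fun e => e.map (·, k) ∈ c.edges).erase e).card :=
                Finset.pred_card_le_card_erase
            _ ≤ _ := by
                refine Finset.card_le_card fun f hf => ?_
                rw [Finset.mem_erase, Finset.mem_filter] at hf
                rw [Finset.mem_filter]
                exact ⟨hf.2.1, (hce' _ hf.2.2).resolve_left fun h => hf.1 (hinj _ _ _ _ h).1⟩
        · refine (Finset.card_le_card hsub).trans ((hce k hk).trans ?_)
          refine Finset.card_le_card fun f hf => ?_
          rw [Finset.mem_filter] at hf ⊢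
          exact ⟨hf.1, (hce' _ hf.2).resolve_left fun h => hkw (hinj _ _ _ _ h).2⟩
    · refine Finset.card_lt_card (Finset.ssubset_iff.2 ⟨a, ha, ?_⟩)
      exact Finset.insert_subset_insert _ (Finset.subset_insert _ _)
  have hgrow : ∀ n ≤ Fintype.card W, ∃ S, Inv S ∧ n ≤ S.card := by
    intro n
    induction n with
    | zero => exact fun _ => hstart.imp fun S hS => ⟨hS, Nat.zero_le _⟩
    | succ n ih =>
      intro hn
      obtain ⟨S, hS, hnS⟩ := ih (by omega)
      by_cases hSu : S = Finset.univ
      · exact ⟨S, hS, by rwa [hSu, Finset.card_univ]⟩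
      · obtain ⟨S', hS', hlt⟩ := hstep S hS hSu
        exact ⟨S', hS', by omega⟩
  obtain ⟨S, ⟨-, -, z, c, hc, hcs, -⟩, hS⟩ := hgrow _ le_rfl
  have hSu : S = Finset.univ := Finset.eq_univ_of_card S (le_antisymm (Finset.card_le_univ S) hS)
  refine ⟨z, c, hc, hc.isPath_tail.isHamiltonian_of_mem fun x => ?_⟩
  rw [Walk.support_tail_of_not_nil _ hc.not_nil]
  have hx : x ∈ c.support := by simp [hcs, hSu]
  rw [Walk.mem_support_iff] at hx
  obtain rfl | hx := hx
  · exact Walk.end_mem_tail_support hc.not_nil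
  · exact hx

end SimpleGraph

theorem corollary1p2 {V : Type*} {W : Type*}
    [Fintype V] [DecidableEq V] [Fintype W] [DecidableEq W]
    (G₁ : SimpleGraph V) (G₂ : SimpleGraph W) [DecidableRel G₂.Adj]
    (hG₁ : G₁.IsTraceable) (hcard : 3 ≤ Fintype.card V)
    (hconn : G₂.Connected) (hreg : G₂.IsRegularOfDegree 3)
    (hcut : ∀ e ∈ G₂.edgeSet, ¬ G₂.IsBridge e) :
    ∃ (x : V × W) (c : (G₁.boxProd G₂).Walk x x), c.IsHamiltonianCycle := by
  obtain ⟨u, v, p, hp⟩ := hG₁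
  obtain ⟨M, hM⟩ := SimpleGraph.exists_isPerfectMatching_of_isRegularOfDegree_three hreg hcut
  -- Order at least 3 is what bounds the degree 3 by `|V|`.
  exact SimpleGraph.exists_isHamiltonianCycle_boxProd hp (by omega) hconn
    (fun w => (hreg w).trans_le hcard) hM
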